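/- Let $\Bbbk$ be an algebraically closed field of characteristic zero and let $n \ge 3$. Let $Q$ be the cyclically oriented quiver with vertices $e_i$ and exactly one arrow $\alpha_i : e_i \to e_{i+1}$ for each $i \in \mathbb{Z}/n$ (the extended Dynkin quiver of type $A$ with $n$ vertices), and let $\overline{Q}$ be its double, with additional arrows $\alpha_i^* : e_{i+1} \to e_i$. Let $R = \Bbbk\overline{Q}/(\Omega)$, $\Omega = \sum_i (\alpha_i\alpha_i^* - \alpha_i^*\alpha_i)$, be the preprojective algebra of $Q$, where paths are multiplied by concatenation from left to right, graded by path length: $R = \bigoplus_{d \ge 0} R_d$. Let $D_n = \langle \rho, r\rangle$ be the dihedral group of graded algebra automorphisms of $R$ generated by $$\rho:\ e_i \mapsto e_{i+1},\ \alpha_i \mapsto \alpha_{i+1},\ \alpha_i^* \mapsto \alpha_{i+1}^*, \qquad r:\ e_i \mapsto e_{-i},\ \alpha_i \mapsto \alpha_{-i-1}^*,\ \alpha_i^* \mapsto \alpha_{-i-1}.$$ Let $R\# D_n$ be the skew group ring, with multiplication $(a\# g)(b\# h) = a\,g(b)\# gh$, and let $\operatorname{End}_{R^{D_n}} R$ be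 the ring of endomorphisms of $R$ as a right module over the fixed ring $R^{D_n}$. Then the Auslander map $$\eta : R\# D_n \to \operatorname{End}_{R^{D_n}} R, \qquad a \# g \mapsto \big(b \mapsto a\,g(b)\big),$$ is not an isomorphism. Moreover: (1) Let $s_1 = \sum_i (\alpha_i + \alpha_i^*) \in R_1$ and $s_2 = \sum_i (\alpha_i\alpha_{i+1} + \alpha_i^*\alpha_{i-1}^*) \in R_2$. These are the sums over the $D_n$-orbits of $\alpha_0$ and of $\alpha_0\alpha_1$, and $R^{D_n} = \Bbbk[s_1,s_2]$ is a polynomial ring in $s_1, s_2$. (2) $R$ is a free right $R^{D_n}$-module of rank $2n$ with basis $e_0,\dots,e_{n-1},\alpha_0,\dots,\alpha_{n-1}$. (3) There is $\psi \in \operatorname{End}_{R^{D_n}} R$ of degree $-1$, that is, $\psi(R_0) = 0$ and $\psi(R_{d+1}) \subseteq R_d$ for all $d \ge 0$, which does not lie in the image of $\eta$. -/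

import Mathlib

universe u v w

noncomputable section

/-! ### The path algebra of a quiver -/

/-- The path algebra of the quiver `V`: the free `k`-module on the set of all paths.
Multiplication is concatenation of paths, `p * q` being "first `p`, then `q`". -/
def PathAlgebra (k : Type u) (V : Type v) [Quiver.{w} V] [CommRing k] : Type (max u v w) :=
  (Σ a b : V, Quiver.Path a b) →₀ k

namespace PathAlgebra

variable {k : Type u} {V : Type v} [Quiver.{w} V] [CommRing k]

instance : AddCommGroup (PathAlgebra k V) :=
  inferInstanceAs (AddCommGroup ((Σ a b : V, Quiver.Path a b) →₀ k))

instance : Module k (PathAlgebra k V) :=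
  inferInstanceAs (Module k ((Σ a b : V, Quiver.Path a b) →₀ k))

/-- A path as a basis element of the path algebra. -/
def ofPath {a b : V} (p : Quiver.Path a b) : PathAlgebra k V :=
  Finsupp.single (⟨a, b, p⟩ : Σ a b : V, Quiver.Path a b) (1 : k)

/-- The linear map out of the path algebra with prescribed values on paths. -/
def linearLift {M : Type*} [AddCommGroup M] [Module k M]
    (f : (Σ a b : V, Quiver.Path a b) → M) : PathAlgebra k V →ₗ[k] M :=
  Finsupp.linearCombination k f

theorem linearLift_ofPath {M : Type*} [AddCommGroup M] [Module k M]
    (f : (Σ a b : V, Quiver.Path a b) → M) {a b : V} (p : Quiver.Path a b) :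
    linearLift f (ofPath p : PathAlgebra k V) = f ⟨a, b, p⟩ := by
  exact (Finsupp.linearCombination_single k (1 : k) _).trans (one_smul k _)

theorem linear_ext {M : Type*} [AddCommGroup M] [Module k M] {f g : PathAlgebra k V →ₗ[k] M}
    (h : ∀ {a b : V} (p : Quiver.Path a b), f (ofPath p) = g (ofPath p)) : f = g := by
  refine Finsupp.lhom_ext' fun x => LinearMap.ext_ring ?_
  obtain ⟨a, b, p⟩ := x
  exact h p

open Classical in
/-- The product of two paths: their concatenation if the target of the first is the source of the
second, and `0` otherwise. -/
def pathMul (p q : Σ a b : V, Quiver.Path a b) : PathAlgebra k V :=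
  if h : p.2.1 = q.1 then ofPath (p.2.2.comp (q.2.2.cast h.symm rfl)) else 0

/-- The bilinear extension of the product of paths. -/
def mulLin : PathAlgebra k V →ₗ[k] PathAlgebra k V →ₗ[k] PathAlgebra k V :=
  linearLift fun p => linearLift fun q => pathMul p q

instance : Mul (PathAlgebra k V) := ⟨fun x y => mulLin x y⟩

theorem mul_def (x y : PathAlgebra k V) : x * y = mulLin x y := rfl

theorem ofPath_mul_ofPath {a b c : V} (p : Quiver.Path a b) (q : Quiver.Path b c) :
    (ofPath p * ofPath q : PathAlgebra k V) = ofPath (p.comp q) := by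
  simp [mul_def, mulLin, linearLift_ofPath, pathMul]

theorem ofPath_mul_ofPath_of_ne {a b c d : V} (p : Quiver.Path a b) (q : Quiver.Path c d)
    (h : b ≠ c) : (ofPath p * ofPath q : PathAlgebra k V) = 0 := by
  simp [mul_def, mulLin, linearLift_ofPath, pathMul, h]

theorem ofPath_mul_assoc {a b c d e f : V} (p : Quiver.Path a b) (q : Quiver.Path c d)
    (r : Quiver.Path e f) :
    (ofPath p * ofPath q * ofPath r : PathAlgebra k V) = ofPath p * (ofPath q * ofPath r) := by
  by_cases h : b = c
  · subst h
    by_cases h' : d = e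
    · subst h'
      simp [ofPath_mul_ofPath]
    · rw [ofPath_mul_ofPath, ofPath_mul_ofPath_of_ne _ _ h', ofPath_mul_ofPath_of_ne _ _ h',
        mul_def, map_zero]
  · by_cases h' : d = e
    · subst h'
      rw [ofPath_mul_ofPath, ofPath_mul_ofPath_of_ne _ _ h, ofPath_mul_ofPath_of_ne _ _ h,
        mul_def, map_zero, LinearMap.zero_apply]
    · rw [ofPath_mul_ofPath_of_ne _ _ h, ofPath_mul_ofPath_of_ne _ _ h',
        mul_def, mul_def, map_zero, map_zero, LinearMap.zero_apply]

theorem induction {P : PathAlgebra k V → Prop} (x : PathAlgebra k V)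
    (path : ∀ {a b : V} (p : Quiver.Path a b), P (ofPath p)) (zero : P 0)
    (add : ∀ x y, P x → P y → P (x + y)) (smul : ∀ (c : k) x, P x → P (c • x)) : P x := by
  refine Finsupp.induction_linear (motive := P) x zero (fun f g hf hg => add f g hf hg) ?_
  rintro ⟨a, b, p⟩ c
  have h : (Finsupp.single (⟨a, b, p⟩ : Σ a b : V, Quiver.Path a b) c) =
      (c • (ofPath p : PathAlgebra k V) : PathAlgebra k V) := by
    refine Eq.trans ?_ (Finsupp.smul_single c _ (1 : k)).symm
    simp
  exact h ▸ smul c _ (path p)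

instance : NonUnitalRing (PathAlgebra k V) where
  left_distrib x y z := by simp only [mul_def, map_add]
  right_distrib x y z := by simp only [mul_def, map_add, LinearMap.add_apply]
  zero_mul x := by simp only [mul_def, map_zero, LinearMap.zero_apply]
  mul_zero x := by simp only [mul_def, map_zero]
  mul_assoc x y z := by
    induction x using induction with
    | zero => simp only [mul_def, map_zero, LinearMap.zero_apply]
    | add x x' h h' => simp only [mul_def, map_add, LinearMap.add_apply] at *; rw [h, h']
    | smul c x h => simp only [mul_def, map_smul, LinearMap.smul_apply] at *; rw [h]
    | path p =>
      induction y using induction with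
      | zero => simp only [mul_def, map_zero, LinearMap.zero_apply]
      | add x x' h h' => simp only [mul_def, map_add, LinearMap.add_apply] at *; rw [h, h']
      | smul c x h => simp only [mul_def, map_smul, LinearMap.smul_apply] at *; rw [h]
      | path q =>
        induction z using induction with
        | zero => simp only [mul_def, map_zero]
        | add x x' h h' => simp only [mul_def, map_add] at *; rw [h, h']
        | smul c x h => simp only [mul_def, map_smul] at *; rw [h]
        | path r => exact ofPath_mul_assoc p q r

/-- The trivial path at a vertex. -/
def vertex (a : V) : PathAlgebra k V := ofPath (Quiver.Path.nil : Quiver.Path a a)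

/-- An arrow, as a path of length one. -/
def arrow {a b : V} (f : a ⟶ b) : PathAlgebra k V := ofPath f.toPath

theorem vertex_mul_vertex [DecidableEq V] (a b : V) :
    (vertex a * vertex b : PathAlgebra k V) = if a = b then vertex a else 0 := by
  split_ifs with h
  · subst h
    exact ofPath_mul_ofPath _ _
  · exact ofPath_mul_ofPath_of_ne _ _ h

theorem vertex_mul_arrow {a b : V} (f : a ⟶ b) :
    (vertex a * arrow f : PathAlgebra k V) = arrow f := by
  rw [vertex, arrow, ofPath_mul_ofPath, Quiver.Path.nil_comp]

theorem arrow_mul_vertex {a b : V} (f : a ⟶ b) :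
    (arrow f * vertex b : PathAlgebra k V) = arrow f :=
  ofPath_mul_ofPath _ _

variable [Fintype V]

instance : One (PathAlgebra k V) := ⟨∑ a : V, vertex a⟩

theorem one_def : (1 : PathAlgebra k V) = ∑ a : V, vertex a := rfl

instance : Ring (PathAlgebra k V) where
  __ := (inferInstance : NonUnitalRing (PathAlgebra k V))
  one_mul x := by
    induction x using induction with
    | zero => exact mul_zero _
    | add x y hx hy => rw [mul_add, hx, hy]
    | smul c x h => rw [mul_def, map_smul, ← mul_def, h]
    | path p =>
      rename_i a b
      rw [one_def, Finset.sum_mul, Finset.sum_eq_single a]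
      · rw [vertex, ofPath_mul_ofPath, Quiver.Path.nil_comp]
      · exact fun c _ hc => ofPath_mul_ofPath_of_ne _ _ hc
      · simp
  mul_one x := by
    induction x using induction with
    | zero => exact zero_mul _
    | add x y hx hy => rw [add_mul, hx, hy]
    | smul c x h => rw [mul_def, map_smul, LinearMap.smul_apply, ← mul_def, h]
    | path p =>
      rename_i a b
      rw [one_def, Finset.mul_sum, Finset.sum_eq_single b]
      · rw [vertex, ofPath_mul_ofPath, Quiver.Path.comp_nil]
      · exact fun c _ hc => ofPath_mul_ofPath_of_ne _ _ hc.symm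
      · simp

instance : Algebra k (PathAlgebra k V) :=
  Algebra.ofModule
    (fun c x y => by simp only [mul_def, map_smul, LinearMap.smul_apply])
    (fun c x y => by simp only [mul_def, map_smul])

section Lift

variable {A : Type*} [Ring A] [Algebra k A]

/-- The value of a path when vertices and arrows are sent to elements of a ring. -/
def evalPath (e : V → A) (x : ∀ {a b : V}, (a ⟶ b) → A) {a : V} :
    ∀ {b : V}, Quiver.Path a b → A
  | _, .nil => e a
  | _, .cons p f => evalPath e x p * x f

/-- Universal property of the path algebra: a complete family of orthogonal idempotents indexed by
the vertices, together with compatible elements for the arrows, defines an algebra homomorphism. -/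
def lift [DecidableEq V] (e : V → A) (x : ∀ {a b : V}, (a ⟶ b) → A)
    (hone : ∑ a, e a = 1) (hmul : ∀ a b, e a * e b = if a = b then e a else 0)
    (_hl : ∀ {a b : V} (f : a ⟶ b), e a * x f = x f)
    (hr : ∀ {a b : V} (f : a ⟶ b), x f * e b = x f) : PathAlgebra k V →ₐ[k] A :=
  have left {a b : V} (p : Quiver.Path a b) : e a * evalPath e x p = evalPath e x p := by
    induction p with
    | nil => simp [evalPath, hmul]
    | cons p f ih => rw [evalPath, ← mul_assoc, ih]
  have right {a b : V} (p : Quiver.Path a b) : evalPath e x p * e b = evalPath e x p := by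
    cases p with
    | nil => simp [evalPath, hmul]
    | cons p f => rw [evalPath, mul_assoc, hr]
  have comp {a b c : V} (p : Quiver.Path a b) (q : Quiver.Path b c) :
      evalPath e x (p.comp q) = evalPath e x p * evalPath e x q := by
    induction q with
    | nil => exact (right p).symm
    | cons q f ih => rw [Quiver.Path.comp_cons, evalPath, evalPath, ih, mul_assoc]
  let L : PathAlgebra k V →ₗ[k] A := linearLift fun p => evalPath e x p.2.2
  have hL {a b : V} (p : Quiver.Path a b) : L (ofPath p) = evalPath e x p := linearLift_ofPath _ p
  AlgHom.ofLinearMap L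
    (by
      rw [one_def, map_sum, ← hone]
      exact Finset.sum_congr rfl fun a _ => hL _)
    (by
      intro y z
      induction y using induction with
      | zero => rw [zero_mul, map_zero, zero_mul]
      | add y y' h h' => rw [add_mul, map_add, map_add, h, h', add_mul]
      | smul c y h => rw [smul_mul_assoc, map_smul, map_smul, h, smul_mul_assoc]
      | path p =>
        induction z using induction with
        | zero => rw [mul_zero, map_zero, mul_zero]
        | add y y' h h' => rw [mul_add, map_add, map_add, h, h', mul_add]
        | smul c y h => rw [mul_smul_comm, map_smul, map_smul, h, mul_smul_comm]
        | path q =>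
          rename_i a b c d
          by_cases hbc : b = c
          · subst hbc
            rw [ofPath_mul_ofPath, hL, hL, hL, comp]
          · rw [ofPath_mul_ofPath_of_ne _ _ hbc, hL, hL, map_zero, ← right p, ← left q, mul_assoc,
              ← mul_assoc (e b), hmul, if_neg hbc, zero_mul, mul_zero])

theorem lift_vertex [DecidableEq V] (e : V → A) (x : ∀ {a b : V}, (a ⟶ b) → A)
    (hone : ∑ a, e a = 1) (hmul : ∀ a b, e a * e b = if a = b then e a else 0)
    (hl : ∀ {a b : V} (f : a ⟶ b), e a * x f = x f)
    (hr : ∀ {a b : V} (f : a ⟶ b), x f * e b = x f) (a : V) :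
    lift (k := k) e x hone hmul hl hr (vertex a) = e a :=
  linearLift_ofPath _ _

theorem lift_arrow [DecidableEq V] (e : V → A) (x : ∀ {a b : V}, (a ⟶ b) → A)
    (hone : ∑ a, e a = 1) (hmul : ∀ a b, e a * e b = if a = b then e a else 0)
    (hl : ∀ {a b : V} (f : a ⟶ b), e a * x f = x f)
    (hr : ∀ {a b : V} (f : a ⟶ b), x f * e b = x f) {a b : V} (f : a ⟶ b) :
    lift (k := k) e x hone hmul hl hr (arrow f) = x f :=
  (linearLift_ofPath _ _).trans (hl f)

theorem algHom_ext {F G : PathAlgebra k V →ₐ[k] A} (hv : ∀ a, F (vertex a) = G (vertex a))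
    (ha : ∀ {a b : V} (f : a ⟶ b), F (arrow f) = G (arrow f)) : F = G := by
  have h : F.toLinearMap = G.toLinearMap := by
    refine linear_ext fun p => ?_
    induction p with
    | nil => exact hv _
    | cons p f ih =>
      have : (ofPath (p.cons f) : PathAlgebra k V) = ofPath p * arrow f := by
        rw [arrow, ofPath_mul_ofPath, Quiver.Path.comp_toPath_eq_cons]
      simp only [AlgHom.toLinearMap_apply] at *
      rw [this, map_mul, map_mul, ih, ha]
  exact AlgHom.toLinearMap_injective h

end Lift

end PathAlgebra

/-! ### Preprojective algebras -/

instance (V : Type*) [Fintype V] : Fintype (Quiver.Symmetrify V) := inferInstanceAs (Fintype V)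

instance (V : Type*) [DecidableEq V] : DecidableEq (Quiver.Symmetrify V) :=
  inferInstanceAs (DecidableEq V)

section Preprojective

variable (k : Type u) (V : Type v) [CommRing k] [Quiver.{w} V] [Fintype V]
  [∀ a b : V, Fintype (a ⟶ b)]

open PathAlgebra in
/-- The element `∑ (α α* - α* α)`, the sum being over all arrows `α` of the quiver, of the path
algebra of the double quiver. `Quiver.Symmetrify V` is the double of `V`; for an arrow `f` of `V`,
`f.toPos` is `f` and `f.toNeg` is `f*`. -/
def preprojectiveRelation : PathAlgebra k (Quiver.Symmetrify V) :=
  ∑ a : V, ∑ b : V, ∑ f : a ⟶ b, (arrow f.toPos * arrow f.toNeg - arrow f.toNeg * arrow f.toPos)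

/-- The preprojective algebra: the quotient of the path algebra of the double quiver by the
two-sided ideal generated by the preprojective relation. -/
def Preprojective : Type (max u v w) :=
  RingQuot fun x y : PathAlgebra k (Quiver.Symmetrify V) => x = preprojectiveRelation k V ∧ y = 0

namespace Preprojective

instance : Ring (Preprojective k V) := inferInstanceAs (Ring (RingQuot _))

instance : Algebra k (Preprojective k V) := inferInstanceAs (Algebra k (RingQuot _))

/-- The quotient map from the path algebra of the double quiver. -/
def mk : PathAlgebra k (Quiver.Symmetrify V) →ₐ[k] Preprojective k V := RingQuot.mkAlgHom k _

theorem mk_relation : mk k V (preprojectiveRelation k V) = 0 :=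
  (RingQuot.mkAlgHom_rel k ⟨rfl, rfl⟩).trans (map_zero (mk k V))

/-- The degree `d` part of the preprojective algebra: the span of the paths of length `d`. -/
def degreePart (d : ℕ) : Submodule k (Preprojective k V) :=
  Submodule.span k {x | ∃ (a b : Quiver.Symmetrify V) (p : Quiver.Path a b),
    p.length = d ∧ mk k V (PathAlgebra.ofPath p) = x}

variable {k V} {A : Type*} [Ring A] [Algebra k A]

/-- Universal property of the quotient. -/
def lift (F : PathAlgebra k (Quiver.Symmetrify V) →ₐ[k] A)
    (hF : F (preprojectiveRelation k V) = 0) : Preprojective k V →ₐ[k] A :=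
  RingQuot.liftAlgHom k ⟨F, by rintro _ _ ⟨rfl, rfl⟩; rw [hF, map_zero]⟩

theorem lift_mk (F : PathAlgebra k (Quiver.Symmetrify V) →ₐ[k] A)
    (hF : F (preprojectiveRelation k V) = 0) (x : PathAlgebra k (Quiver.Symmetrify V)) :
    lift F hF (mk k V x) = F x :=
  RingQuot.liftAlgHom_mkAlgHom_apply k F _ x

theorem algHom_ext {F G : Preprojective k V →ₐ[k] A}
    (h : F.comp (mk k V) = G.comp (mk k V)) : F = G :=
  RingQuot.ringQuot_ext' k F G h

end Preprojective

end Preprojective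

/-! ### The Auslander map -/

section Auslander

variable (k R G : Type*) [CommRing k] [Ring R] [Algebra k R] [Group G] [MulSemiringAction G R]
  [SMulCommClass G k R]

/-- The endomorphism ring of `R` as a right module over the fixed ring `R ^ G`. -/
abbrev InvariantEnd : Type _ := Module.End (FixedPoints.subalgebra k R G).op R

/-- Left multiplication by an element of `R`. -/
def leftMulInvariantEnd : R →ₐ[k] InvariantEnd k R G where
  toFun a :=
    { toFun := fun b => a * b
      map_add' := mul_add a
      map_smul' := fun s b => (mul_assoc a b s.1.unop).symm }
  map_one' := by ext; exact one_mul _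
  map_mul' a b := by ext; exact mul_assoc _ _ _
  map_zero' := by ext; exact zero_mul _
  map_add' a b := by ext; exact add_mul _ _ _
  commutes' c := by ext; exact (Algebra.smul_def _ _).symm

/-- The action of an element of `G`. -/
def actionInvariantEnd : G →* InvariantEnd k R G where
  toFun g :=
    { toFun := fun b => g • b
      map_add' := smul_add g
      map_smul' := fun s b => by
        change g • (b * s.1.unop) = (g • b) * s.1.unop
        rw [smul_mul']
        congr 1
        exact s.2 g }
  map_one' := by ext; exact one_smul _ _
  map_mul' g h := by ext; exact mul_smul _ _ _

/-- The Auslander map `R # G → End_{R^G} R`, sending `a # g` to `b ↦ a * g(b)`. -/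
def auslanderMap : SkewMonoidAlgebra R G →ₐ[k] InvariantEnd k R G :=
  SkewMonoidAlgebra.liftNCAlgHom (leftMulInvariantEnd k R G) (actionInvariantEnd k R G)
    (by intro a g; ext b; exact (smul_mul' g a b).symm)

theorem auslanderMap_single (g : G) (a b : R) :
    auslanderMap k R G (SkewMonoidAlgebra.single g a) b = a * g • b := by
  have h : auslanderMap k R G (SkewMonoidAlgebra.single g a) =
      leftMulInvariantEnd k R G a * actionInvariantEnd k R G g :=
    SkewMonoidAlgebra.liftNC_single _ _ _ _
  rw [h]
  rfl

/-- The sum of the elements in the orbit of `x`. -/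
def orbitSum {R : Type*} (G : Type*) [AddCommMonoid R] [Group G] [MulAction G R] (x : R) : R :=
  ∑ᶠ y ∈ MulAction.orbit G x, y

end Auslander

/-! ### The preprojective algebra of the extended Dynkin quiver of type A with `n` vertices -/

/-- The vertex set of the cyclically oriented quiver with `n` vertices. -/
abbrev CyclicQuiver (n : ℕ) : Type := ZMod n

namespace CyclicQuiver

variable (n : ℕ)

/-- There is exactly one arrow from `i` to `i + 1` for every `i`, and there are no others. -/
instance : Quiver.{0} (CyclicQuiver n) where
  Hom i j := PLift (j = i + 1)

instance (i j : CyclicQuiver n) : Fintype (i ⟶ j) :=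
  inferInstanceAs (Fintype (PLift (j = i + 1)))

instance (i j : CyclicQuiver n) : Subsingleton (i ⟶ j) :=
  inferInstanceAs (Subsingleton (PLift (j = i + 1)))

variable {n}

/-- The arrow from `i` to `i + 1`. -/
def next (i : CyclicQuiver n) : i ⟶ i + 1 := ⟨rfl⟩

end CyclicQuiver

/-- The preprojective algebra of the extended Dynkin quiver of type A with `n` vertices. -/
abbrev PreprojectiveA (k : Type u) [CommRing k] (n : ℕ) [NeZero n] : Type u :=
  Preprojective k (CyclicQuiver n)

namespace PreprojectiveA

variable (k : Type u) [CommRing k] {n : ℕ} [NeZero n]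

/-- The trivial path at the vertex `i`, in the path algebra of the double quiver. -/
def pathE (i : ZMod n) : PathAlgebra k (Quiver.Symmetrify (CyclicQuiver n)) :=
  PathAlgebra.vertex (V := Quiver.Symmetrify (CyclicQuiver n)) i

/-- The nonstar arrow from `i` to `i + 1`, in the path algebra of the double quiver. -/
def pathα (i : ZMod n) : PathAlgebra k (Quiver.Symmetrify (CyclicQuiver n)) :=
  PathAlgebra.arrow (CyclicQuiver.next i).toPos

/-- The star arrow from `i + 1` to `i`, in the path algebra of the double quiver. -/
def pathαStar (i : ZMod n) : PathAlgebra k (Quiver.Symmetrify (CyclicQuiver n)) :=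
  PathAlgebra.arrow (CyclicQuiver.next i).toNeg

/-- The trivial path at the vertex `i`. -/
def e (i : ZMod n) : PreprojectiveA k n := Preprojective.mk k (CyclicQuiver n) (pathE k i)

/-- The nonstar arrow from `i` to `i + 1`. -/
def α (i : ZMod n) : PreprojectiveA k n := Preprojective.mk k (CyclicQuiver n) (pathα k i)

/-- The star arrow from `i + 1` to `i`. -/
def αStar (i : ZMod n) : PreprojectiveA k n :=
  Preprojective.mk k (CyclicQuiver n) (pathαStar k i)

theorem relation_eq : preprojectiveRelation k (CyclicQuiver n) =
    ∑ i : ZMod n, (pathα k i * pathαStar k i - pathαStar k i * pathα k i) := by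
  refine Finset.sum_congr rfl fun i _ => ?_
  refine (Finset.sum_eq_single (i + 1) ?_ (by simp)).trans ?_
  · intro j _ hj
    exact Finset.sum_eq_zero fun f _ => (hj f.down).elim
  · exact Fintype.sum_subsingleton _ (CyclicQuiver.next i)

theorem sum_e : ∑ i : ZMod n, e k i = 1 := by
  rw [← map_one (Preprojective.mk k (CyclicQuiver n)), PathAlgebra.one_def, map_sum]
  rfl

theorem e_mul_e (i j : ZMod n) : e k i * e k j = if i = j then e k i else 0 := by
  have h := congrArg (Preprojective.mk k (CyclicQuiver n))
    (PathAlgebra.vertex_mul_vertex (V := Quiver.Symmetrify (CyclicQuiver n)) i j)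
  rw [map_mul, apply_ite (Preprojective.mk k (CyclicQuiver n)), map_zero] at h
  exact h

theorem e_mul_α (i : ZMod n) : e k i * α k i = α k i := by
  rw [e, α, ← map_mul]
  exact congrArg _ (PathAlgebra.vertex_mul_arrow _)

theorem α_mul_e (i : ZMod n) : α k i * e k (i + 1) = α k i := by
  rw [e, α, ← map_mul]
  exact congrArg _ (PathAlgebra.arrow_mul_vertex _)

theorem e_mul_αStar (i : ZMod n) : e k (i + 1) * αStar k i = αStar k i := by
  rw [e, αStar, ← map_mul]
  exact congrArg _ (PathAlgebra.vertex_mul_arrow _)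

theorem αStar_mul_e (i : ZMod n) : αStar k i * e k i = αStar k i := by
  rw [e, αStar, ← map_mul]
  exact congrArg _ (PathAlgebra.arrow_mul_vertex _)

theorem relation : ∑ i : ZMod n, (α k i * αStar k i - αStar k i * α k i) = 0 := by
  rw [← Preprojective.mk_relation k (CyclicQuiver n), relation_eq, map_sum]
  simp only [map_sub, map_mul]
  rfl

section Lift

variable {A : Type*} [Ring A] [Algebra k A]

theorem algHom_ext {F G : PreprojectiveA k n →ₐ[k] A} (he : ∀ i, F (e k i) = G (e k i))
    (hα : ∀ i, F (α k i) = G (α k i)) (hs : ∀ i, F (αStar k i) = G (αStar k i)) : F = G := by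
  refine Preprojective.algHom_ext (PathAlgebra.algHom_ext he ?_)
  rintro (i : ZMod n) (j : ZMod n) (⟨⟨h⟩⟩ | ⟨⟨h⟩⟩)
  · subst h
    exact hα i
  · subst h
    exact hs j

variable (E x y : ZMod n → A) (hone : ∑ i, E i = 1)
    (hmul : ∀ i j, E i * E j = if i = j then E i else 0)
    (hx : ∀ i, E i * x i = x i) (hx' : ∀ i, x i * E (i + 1) = x i)
    (hy : ∀ i, E (i + 1) * y i = y i) (hy' : ∀ i, y i * E i = y i)
    (hrel : ∑ i, (x i * y i - y i * x i) = 0)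

/-- The values on the arrows of the double quiver determined by the values on the nonstar and on
the star arrows. -/
def arrowValue {i j : Quiver.Symmetrify (CyclicQuiver n)} : (i ⟶ j) → A
  | Sum.inl _ => x i
  | Sum.inr _ => y j

/-- The homomorphism from the path algebra of the double quiver with prescribed values on vertices,
nonstar and star arrows. -/
def pathLift : PathAlgebra k (Quiver.Symmetrify (CyclicQuiver n)) →ₐ[k] A :=
  PathAlgebra.lift (V := Quiver.Symmetrify (CyclicQuiver n)) E (arrowValue x y) hone hmul
    (by
      rintro (i : ZMod n) (j : ZMod n) (⟨⟨h⟩⟩ | ⟨⟨h⟩⟩)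
      · exact hx i
      · subst h
        exact hy j)
    (by
      rintro (i : ZMod n) (j : ZMod n) (⟨⟨h⟩⟩ | ⟨⟨h⟩⟩)
      · subst h
        exact hx' i
      · exact hy' j)

theorem pathLift_pathE (i : ZMod n) :
    pathLift k E x y hone hmul hx hx' hy hy' (pathE k i) = E i :=
  PathAlgebra.linearLift_ofPath _ _

theorem pathLift_pathα (i : ZMod n) :
    pathLift k E x y hone hmul hx hx' hy hy' (pathα k i) = x i :=
  (PathAlgebra.linearLift_ofPath _ _).trans (hx i)

theorem pathLift_pathαStar (i : ZMod n) :
    pathLift k E x y hone hmul hx hx' hy hy' (pathαStar k i) = y i :=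
  (PathAlgebra.linearLift_ofPath _ _).trans (hy i)

theorem pathLift_relation (hrel : ∑ i, (x i * y i - y i * x i) = 0) : pathLift k E x y hone hmul hx hx' hy hy'
    (preprojectiveRelation k (CyclicQuiver n)) = 0 := by
  rw [relation_eq, map_sum, ← hrel]
  refine Finset.sum_congr rfl fun i _ => ?_
  rw [map_sub, map_mul, map_mul, pathLift_pathα, pathLift_pathαStar]

/-- The algebra homomorphism with prescribed values on vertices, nonstar and star arrows. -/
def lift : PreprojectiveA k n →ₐ[k] A :=
  Preprojective.lift (pathLift k E x y hone hmul hx hx' hy hy')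
    (pathLift_relation k E x y hone hmul hx hx' hy hy' hrel)

theorem lift_e (i : ZMod n) : lift k E x y hone hmul hx hx' hy hy' hrel (e k i) = E i :=
  (Preprojective.lift_mk _ _ _).trans (pathLift_pathE k E x y hone hmul hx hx' hy hy' i)

theorem lift_α (i : ZMod n) : lift k E x y hone hmul hx hx' hy hy' hrel (α k i) = x i :=
  (Preprojective.lift_mk _ _ _).trans (pathLift_pathα k E x y hone hmul hx hx' hy hy' i)

theorem lift_αStar (i : ZMod n) : lift k E x y hone hmul hx hx' hy hy' hrel (αStar k i) = y i :=
  (Preprojective.lift_mk _ _ _).trans (pathLift_pathαStar k E x y hone hmul hx hx' hy hy' i)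

end Lift

/-! ### The dihedral group -/

/-- The endomorphism sending `e i`, `α i`, `αStar i` to `e (i + c)`, `α (i + c)`,
`αStar (i + c)`. -/
def shiftHom (c : ZMod n) : PreprojectiveA k n →ₐ[k] PreprojectiveA k n :=
  lift k (fun i => e k (i + c)) (fun i => α k (i + c)) (fun i => αStar k (i + c))
    (by rw [← sum_e k]; exact Equiv.sum_comp (Equiv.addRight c) (e k))
    (fun i j => by rw [e_mul_e]; congr 1; exact propext (add_left_inj c))
    (fun i => e_mul_α k _)
    (fun i => by rw [add_right_comm]; exact α_mul_e k _)
    (fun i => by rw [add_right_comm]; exact e_mul_αStar k _)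
    (fun i => αStar_mul_e k _)
    (by
      rw [← relation k]
      exact Equiv.sum_comp (Equiv.addRight c) fun i => α k i * αStar k i - αStar k i * α k i)

/-- The endomorphism sending `e i`, `α i`, `αStar i` to `e (-i)`, `αStar (-i - 1)`,
`α (-i - 1)`. -/
def reflectionHom : PreprojectiveA k n →ₐ[k] PreprojectiveA k n :=
  lift k (fun i => e k (-i)) (fun i => αStar k (-i - 1)) (fun i => α k (-i - 1))
    (by rw [← sum_e k]; exact Equiv.sum_comp (Equiv.neg (ZMod n)) (e k))
    (fun i j => by rw [e_mul_e]; congr 1; exact propext neg_inj)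
    (fun i => by have h := e_mul_αStar k (-i - 1); rw [sub_add_cancel] at h; exact h)
    (fun i => by rw [neg_add']; exact αStar_mul_e k _)
    (fun i => by rw [neg_add']; exact e_mul_α k _)
    (fun i => by have h := α_mul_e k (-i - 1); rw [sub_add_cancel] at h; exact h)
    (by
      have h := Equiv.sum_comp (Equiv.subLeft (-1 : ZMod n))
        fun i => α k i * αStar k i - αStar k i * α k i
      rw [relation k] at h
      rw [← neg_eq_zero, ← Finset.sum_neg_distrib, ← h]
      refine Finset.sum_congr rfl fun i _ => ?_
      rw [neg_sub, Equiv.subLeft_apply, show (-1 - i : ZMod n) = -i - 1 by ring])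

variable (n)

/-- The rotation: `e i ↦ e (i + 1)`, `α i ↦ α (i + 1)`, `αStar i ↦ αStar (i + 1)`. -/
def rotation : PreprojectiveA k n ≃ₐ[k] PreprojectiveA k n :=
  AlgEquiv.ofAlgHom (shiftHom k 1) (shiftHom k (-1))
    (algHom_ext k (by simp [shiftHom, lift_e]) (by simp [shiftHom, lift_α])
      (by simp [shiftHom, lift_αStar]))
    (algHom_ext k (by simp [shiftHom, lift_e]) (by simp [shiftHom, lift_α])
      (by simp [shiftHom, lift_αStar]))

/-- The reflection: `e i ↦ e (-i)`, `α i ↦ αStar (-i - 1)`, `αStar i ↦ α (-i - 1)`. -/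
def reflection : PreprojectiveA k n ≃ₐ[k] PreprojectiveA k n :=
  AlgEquiv.ofAlgHom (reflectionHom k) (reflectionHom k)
    (algHom_ext k (by simp [reflectionHom, lift_e]) (by simp [reflectionHom, lift_α, lift_αStar])
      (by simp [reflectionHom, lift_α, lift_αStar]))
    (algHom_ext k (by simp [reflectionHom, lift_e]) (by simp [reflectionHom, lift_α, lift_αStar])
      (by simp [reflectionHom, lift_α, lift_αStar]))

/-- The dihedral group, as a group of automorphisms of the preprojective algebra. -/
def dihedral : Subgroup (PreprojectiveA k n ≃ₐ[k] PreprojectiveA k n) :=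
  Subgroup.closure {rotation k n, reflection k n}

variable {n}

theorem rotation_e (i : ZMod n) : rotation k n (e k i) = e k (i + 1) := lift_e ..

theorem rotation_α (i : ZMod n) : rotation k n (α k i) = α k (i + 1) := lift_α ..

theorem rotation_αStar (i : ZMod n) : rotation k n (αStar k i) = αStar k (i + 1) := lift_αStar ..

theorem reflection_e (i : ZMod n) : reflection k n (e k i) = e k (-i) := lift_e ..

theorem reflection_α (i : ZMod n) : reflection k n (α k i) = αStar k (-i - 1) := lift_α ..

theorem reflection_αStar (i : ZMod n) : reflection k n (αStar k i) = α k (-i - 1) :=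
  lift_αStar ..

variable (n)

/-- The fixed ring of the dihedral group. -/
abbrev invariants : Subalgebra k (PreprojectiveA k n) :=
  FixedPoints.subalgebra k (PreprojectiveA k n) (dihedral k n)

/-- The sum of all arrows of the double quiver. -/
def s₁ : PreprojectiveA k n := ∑ i : ZMod n, (α k i + αStar k i)

/-- The sum of all paths of length two consisting of nonstar arrows only or of star arrows only. -/
def s₂ : PreprojectiveA k n :=
  ∑ i : ZMod n, (α k i * α k (i + 1) + αStar k i * αStar k (i - 1))

end PreprojectiveA

end

/-! Let `x` be the sum of the nonstar arrows and `y` the sum of the star arrows. The preprojective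
relation says exactly that `x` and `y` commute, and every arrow is its source idempotent times `x`
or `y`. Hence `R` is the direct sum of the pieces `e i * k[x, y]`: the monomials `e i * x ^ a * y ^
b` span because a path is determined in `R` by its source and its numbers of nonstar and star arrows
(`exists_mk_ofPath_eq`), and they are independent because a matrix representation over `k[X, Y]`
recovers the coefficients (`toPolynomials_ofPolynomials`).

In these coordinates the rotation shifts the index `i` and fixes `x` and `y`, while the reflection
sends `i` to `-i` and swaps `x` and `y`. So the fixed ring is the ring of symmetric polynomials in
`x` and `y`, generated freely by `x + y` and `x ^ 2 + y ^ 2` once 2 is invertible. Since `k[x, y]`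
is free over the symmetric polynomials on `1, x`, the ring `R` is free on the elements `e i` and `e
i * x = α i`.

Freeness allows an endomorphism `lowering` with `e i ↦ 0` and `α i ↦ e i`; on each piece it is the
divided difference `f ↦ (f - f^σ) / (x - y)`, where `σ` swaps `x` and `y`. It lowers degree by one.
Every `a # g` maps `α i` to `a * g(α i)`, a left multiple of an arrow, so no element of the image
can send `α 0` to `e 0` (`augmentation_auslanderMap_α`). -/

noncomputable section

namespace PreprojectiveA

open MvPolynomial

/-! ### Polynomials at two commuting elements of a noncommutative algebra. -/

section Evaluation

variable (k : Type*) [CommRing k] {A : Type*} [Ring A] [Algebra k A] {x y : A}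

/-- Evaluation of polynomials in two variables at two commuting elements of an algebra. -/
def aevalCommute (h : x * y = y * x) : MvPolynomial (Fin 2) k →ₐ[k] A :=
  -- `aeval` needs a commutative target, so the evaluation takes place in the subalgebra generated
  -- by the two commuting elements.
  letI : CommRing (Algebra.adjoin k {x, y}) :=
    { (Algebra.adjoin k {x, y}).toRing with
      mul_comm := (Algebra.isMulCommutative_adjoin k (by
        rintro _ (rfl | rfl) _ (rfl | rfl)
        exacts [rfl, h, h.symm, rfl])).is_comm.comm }
  (Algebra.adjoin k {x, y}).val.comp
    (aeval (![⟨x, Algebra.subset_adjoin (by simp)⟩, ⟨y, Algebra.subset_adjoin (by simp)⟩] :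
      Fin 2 → Algebra.adjoin k {x, y}))

theorem aevalCommute_X_zero (h : x * y = y * x) : aevalCommute k h (X 0) = x := by
  simp [aevalCommute]

theorem aevalCommute_X_one (h : x * y = y * x) : aevalCommute k h (X 1) = y := by
  simp [aevalCommute]

end Evaluation

/-! ### Coordinates on the preprojective algebra: idempotents times polynomials in the two arrow
sums. -/

section Coordinates

variable (k : Type u) [CommRing k] (n : ℕ) [NeZero n]

/-- The sum of the nonstar arrows. -/
def sumα : PreprojectiveA k n := ∑ i : ZMod n, α k i

/-- The sum of the star arrows. -/
def sumαStar : PreprojectiveA k n := ∑ i : ZMod n, αStar k i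

variable {n}

/-- Exactly one nonstar arrow leaves each vertex. This is what turns `α i` into `e i` times a
polynomial. -/
theorem e_mul_sumα (i : ZMod n) : e k i * sumα k n = α k i := by
  rw [sumα, Finset.mul_sum, Finset.sum_eq_single i]
  · exact e_mul_α k i
  · intro j _ hj
    rw [← e_mul_α, ← mul_assoc, e_mul_e, if_neg hj.symm, zero_mul]
  · simp

theorem e_mul_sumαStar (i : ZMod n) : e k (i + 1) * sumαStar k n = αStar k i := by
  rw [sumαStar, Finset.mul_sum, Finset.sum_eq_single i]
  · exact e_mul_αStar k i
  · intro j _ hj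
    rw [← e_mul_αStar, ← mul_assoc, e_mul_e, if_neg (by simpa using hj.symm), zero_mul]
  · simp

theorem α_mul_sumα (i : ZMod n) : α k i * sumα k n = α k i * α k (i + 1) := by
  rw [← α_mul_e, mul_assoc, e_mul_sumα, mul_assoc, e_mul_α]

theorem α_mul_sumαStar (i : ZMod n) : α k i * sumαStar k n = α k i * αStar k i := by
  rw [← α_mul_e, mul_assoc, e_mul_sumαStar, mul_assoc, e_mul_αStar]

theorem αStar_mul_sumα (i : ZMod n) : αStar k i * sumα k n = αStar k i * α k i := by
  rw [← αStar_mul_e, mul_assoc, e_mul_sumα, mul_assoc, e_mul_α]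

theorem αStar_mul_sumαStar (i : ZMod n) :
    αStar k i * sumαStar k n = αStar k i * αStar k (i - 1) := by
  have h := e_mul_sumαStar k (i - 1)
  have h' := e_mul_αStar k (i - 1)
  rw [sub_add_cancel] at h h'
  rw [← αStar_mul_e, mul_assoc, h, mul_assoc, h']

variable (n)

/-- Only composable pairs survive in the two products: `α i` can be followed by no star arrow but
`αStar i`, and conversely. The commutator is therefore the preprojective relation. -/
theorem sumα_mul_sumαStar : sumα k n * sumαStar k n = sumαStar k n * sumα k n := by
  rw [← sub_eq_zero, ← relation k, Finset.sum_sub_distrib]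
  congr 1
  · rw [sumα, Finset.sum_mul]
    exact Finset.sum_congr rfl fun i _ => α_mul_sumαStar k i
  · rw [sumαStar, Finset.sum_mul]
    exact Finset.sum_congr rfl fun i _ => αStar_mul_sumα k i

theorem s₁_eq : s₁ k n = sumα k n + sumαStar k n := Finset.sum_add_distrib

theorem s₂_eq : s₂ k n = sumα k n ^ 2 + sumαStar k n ^ 2 := by
  rw [s₂, Finset.sum_add_distrib, pow_two, pow_two]
  nth_rewrite 1 [sumα]
  nth_rewrite 1 [sumαStar]
  rw [Finset.sum_mul, Finset.sum_mul]
  simp only [α_mul_sumα, αStar_mul_sumαStar]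

/-- Evaluation of polynomials in two variables at the sum of the nonstar arrows and the sum of the
star arrows. -/
def evalSums : MvPolynomial (Fin 2) k →ₐ[k] PreprojectiveA k n :=
  aevalCommute k (sumα_mul_sumαStar k n)

theorem evalSums_X_zero : evalSums k n (X 0) = sumα k n := aevalCommute_X_zero k _

theorem evalSums_X_one : evalSums k n (X 1) = sumαStar k n := aevalCommute_X_one k _

/-- The linear map from families of polynomials to the preprojective algebra sending `f` to
`∑ i, e i * f i`, evaluated at the sums of the nonstar and of the star arrows. -/
def ofPolynomials : (ZMod n → MvPolynomial (Fin 2) k) →ₗ[k] PreprojectiveA k n :=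
  ∑ i : ZMod n, LinearMap.mulLeft k (e k i) ∘ₗ (evalSums k n).toLinearMap ∘ₗ LinearMap.proj i

variable {n}

theorem ofPolynomials_apply (f : ZMod n → MvPolynomial (Fin 2) k) :
    ofPolynomials k n f = ∑ i, e k i * evalSums k n (f i) := by
  simp [ofPolynomials]

theorem ofPolynomials_single (i : ZMod n) (p : MvPolynomial (Fin 2) k) :
    ofPolynomials k n (Pi.single i p) = e k i * evalSums k n p := by
  rw [ofPolynomials_apply, Finset.sum_eq_single i]
  · rw [Pi.single_eq_same]
  · intro j _ hj
    rw [Pi.single_eq_of_ne hj, map_zero, mul_zero]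
  · simp

theorem ofPolynomials_const (p : MvPolynomial (Fin 2) k) :
    ofPolynomials k n (fun _ => p) = evalSums k n p := by
  rw [ofPolynomials_apply, ← Finset.sum_mul, sum_e, one_mul]

/-! ### A matrix representation separating the coordinates. -/

variable (n)

/-- The representation of the preprojective algebra by matrices over a polynomial ring in two
variables. -/
def toMatrix : PreprojectiveA k n →ₐ[k] Matrix (ZMod n) (ZMod n) (MvPolynomial (Fin 2) k) :=
  lift k (fun i => Matrix.single i i 1) (fun i => Matrix.single i (i + 1) (X 0))
    (fun i => Matrix.single (i + 1) i (X 1))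
    (by
      ext i j : 2
      simp [Matrix.sum_apply, Matrix.single_apply, Matrix.one_apply, ite_and])
    (fun i j => by
      split_ifs with h
      · subst h; simp
      · exact Matrix.single_mul_single_of_ne _ _ _ _ h _)
    (fun i => by simp) (fun i => by simp) (fun i => by simp) (fun i => by simp)
    (by
      simp only [Matrix.single_mul_single_same, Finset.sum_sub_distrib]
      -- The two sides are sums of the same diagonal matrices, one indexed by the source and the
      -- other by the target of the arrows.
      rw [sub_eq_zero, mul_comm (X 1)]
      exact (Equiv.sum_comp (Equiv.addRight (1 : ZMod n))
        fun i => Matrix.single i i (X 0 * X 1 : MvPolynomial (Fin 2) k)).symm)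

/-- The row sums of the matrix representing an element of the preprojective algebra. -/
def toPolynomials : PreprojectiveA k n →ₗ[k] (ZMod n → MvPolynomial (Fin 2) k) where
  toFun r := (toMatrix k n r).mulVec 1
  map_add' r s := by rw [map_add, Matrix.add_mulVec]
  map_smul' c r := by rw [map_smul, Matrix.smul_mulVec]; rfl

variable {n}

theorem toPolynomials_mul (r s : PreprojectiveA k n) :
    toPolynomials k n (r * s) = (toMatrix k n r).mulVec (toPolynomials k n s) := by
  simp [toPolynomials]

theorem toMatrix_sumα_mulVec (p : MvPolynomial (Fin 2) k) :
    (toMatrix k n (sumα k n)).mulVec (fun _ => p) = fun _ => X 0 * p := by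
  funext j
  rw [sumα, map_sum, Matrix.mulVec, dotProduct]
  simp [toMatrix, lift_α, Matrix.sum_apply, Matrix.single_apply, ite_and]

theorem toMatrix_sumαStar_mulVec (p : MvPolynomial (Fin 2) k) :
    (toMatrix k n (sumαStar k n)).mulVec (fun _ => p) = fun _ => X 1 * p := by
  funext j
  rw [sumαStar, map_sum, Matrix.mulVec, dotProduct]
  simp [toMatrix, lift_αStar, Matrix.sum_apply, Matrix.single_apply, ite_and,
    ← eq_sub_iff_add_eq]

theorem toMatrix_e_mulVec (i : ZMod n) (v : ZMod n → MvPolynomial (Fin 2) k) :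
    (toMatrix k n (e k i)).mulVec v = Pi.single i (v i) := by
  rw [toMatrix, lift_e]
  funext j
  rcases eq_or_ne i j with rfl | h
  · simp [Matrix.mulVec, dotProduct, Matrix.single_apply]
  · simp [Matrix.mulVec, dotProduct, h, h.symm]

/-- The matrices of the two arrow sums have a single entry, `X 0` or `X 1`, in each row, so they act
on constant vectors as multiplication by that variable. -/
theorem toPolynomials_evalSums (p : MvPolynomial (Fin 2) k) :
    toPolynomials k n (evalSums k n p) = fun _ => p := by
  induction p using MvPolynomial.induction_on with
  | C c =>
    rw [← algebraMap_eq, AlgHom.commutes, Algebra.algebraMap_eq_smul_one, map_smul]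
    simp [toPolynomials, Algebra.algebraMap_eq_smul_one, Pi.smul_def, -algebraMap_eq]
  | add p q hp hq => rw [map_add, map_add, hp, hq]; rfl
  | mul_X p j h =>
    rw [mul_comm, map_mul, toPolynomials_mul, h]
    fin_cases j
    · exact (congrArg (fun r => (toMatrix k n r).mulVec fun _ => p) (evalSums_X_zero k n)).trans
        (toMatrix_sumα_mulVec k p)
    · exact (congrArg (fun r => (toMatrix k n r).mulVec fun _ => p) (evalSums_X_one k n)).trans
        (toMatrix_sumαStar_mulVec k p)

theorem toPolynomials_ofPolynomials (f : ZMod n → MvPolynomial (Fin 2) k) :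
    toPolynomials k n (ofPolynomials k n f) = f := by
  rw [ofPolynomials_apply, map_sum]
  simp only [toPolynomials_mul, toPolynomials_evalSums, toMatrix_e_mulVec]
  exact Finset.univ_sum_single f

theorem ofPolynomials_injective : Function.Injective (ofPolynomials k n) :=
  Function.LeftInverse.injective (toPolynomials_ofPolynomials k)

theorem evalSums_injective : Function.Injective (evalSums k n) := fun p q h => by
  have := congrArg (toPolynomials k n) h
  rw [toPolynomials_evalSums, toPolynomials_evalSums] at this
  exact congrFun this 0

/-! ### Paths -/

theorem mk_ofPath_mul_vertex {i j : Quiver.Symmetrify (CyclicQuiver n)} (p : Quiver.Path i j) :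
    Preprojective.mk k (CyclicQuiver n) (PathAlgebra.ofPath p) *
        Preprojective.mk k (CyclicQuiver n) (PathAlgebra.vertex j) =
      Preprojective.mk k (CyclicQuiver n) (PathAlgebra.ofPath p) := by
  rw [← map_mul]
  exact congrArg _ (PathAlgebra.ofPath_mul_ofPath _ _)

theorem mk_arrow_eq : ∀ {i j : Quiver.Symmetrify (CyclicQuiver n)} (f : i ⟶ j),
    Preprojective.mk k (CyclicQuiver n) (PathAlgebra.arrow f) =
        Preprojective.mk k (CyclicQuiver n) (PathAlgebra.vertex i) * sumα k n ∨
      Preprojective.mk k (CyclicQuiver n) (PathAlgebra.arrow f) =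
        Preprojective.mk k (CyclicQuiver n) (PathAlgebra.vertex i) * sumαStar k n := by
  rintro (i : ZMod n) (j : ZMod n) (⟨⟨h⟩⟩ | ⟨⟨h⟩⟩)
  · subst h
    exact Or.inl (e_mul_sumα k i).symm
  · subst h
    exact Or.inr (e_mul_sumαStar k j).symm

theorem mk_ofPath_cons {i j l : Quiver.Symmetrify (CyclicQuiver n)} (p : Quiver.Path i j)
    (f : j ⟶ l) : Preprojective.mk k (CyclicQuiver n) (PathAlgebra.ofPath (p.cons f)) =
      Preprojective.mk k (CyclicQuiver n) (PathAlgebra.ofPath p) *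
        Preprojective.mk k (CyclicQuiver n) (PathAlgebra.arrow f) := by
  rw [PathAlgebra.arrow, ← map_mul, PathAlgebra.ofPath_mul_ofPath,
    Quiver.Path.comp_toPath_eq_cons]

/-- Each arrow is its source idempotent times one of the two arrow sums, the idempotent is absorbed
by the preceding path, and the sums commute. Keeping `a + b` equal to the length makes the result
usable for the grading. -/
theorem exists_mk_ofPath_eq {i j : Quiver.Symmetrify (CyclicQuiver n)} (p : Quiver.Path i j) :
    ∃ a b : ℕ, a + b = p.length ∧ Preprojective.mk k (CyclicQuiver n) (PathAlgebra.ofPath p) =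
      Preprojective.mk k (CyclicQuiver n) (PathAlgebra.vertex i) *
        sumα k n ^ a * sumαStar k n ^ b := by
  induction p with
  | nil => exact ⟨0, 0, rfl, by rw [pow_zero, pow_zero, mul_one, mul_one]; rfl⟩
  | @cons j l p f ih =>
    obtain ⟨a, b, hab, h⟩ := ih
    rw [mk_ofPath_cons, Quiver.Path.length_cons, ← hab]
    obtain hf | hf := mk_arrow_eq k f
    · refine ⟨a + 1, b, by ring, ?_⟩
      rw [hf, ← mul_assoc, mk_ofPath_mul_vertex, h, mul_assoc,
        ((show Commute (sumα k n) (sumαStar k n) from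
          sumα_mul_sumαStar k n).symm.pow_left b).eq, pow_succ]
      simp only [mul_assoc]
    · refine ⟨a, b + 1, by ring, ?_⟩
      rw [hf, ← mul_assoc, mk_ofPath_mul_vertex, h, pow_succ]
      simp only [mul_assoc]

theorem span_monomials_eq_top :
    Submodule.span k (Set.range fun t : ZMod n × ℕ × ℕ =>
      e k t.1 * sumα k n ^ t.2.1 * sumαStar k n ^ t.2.2) = ⊤ := by
  rw [eq_top_iff]
  rintro r -
  obtain ⟨q, rfl⟩ := RingQuot.mkAlgHom_surjective k _ r
  induction q using PathAlgebra.induction with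
  | @path i j p =>
    obtain ⟨a, b, -, h⟩ := exists_mk_ofPath_eq k p
    exact Submodule.subset_span ⟨(i, a, b), h.symm⟩
  | zero => rw [map_zero]; exact zero_mem _
  | add q q' h h' => rw [map_add]; exact add_mem h h'
  | smul c q h => rw [map_smul]; exact Submodule.smul_mem _ _ h

theorem ofPolynomials_surjective : Function.Surjective (ofPolynomials k n) := by
  rw [← LinearMap.range_eq_top, eq_top_iff, ← span_monomials_eq_top, Submodule.span_le]
  rintro _ ⟨⟨i, a, b⟩, rfl⟩
  refine ⟨Pi.single i (X 0 ^ a * X 1 ^ b), ?_⟩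
  rw [ofPolynomials_single, map_mul, map_pow, map_pow, evalSums_X_zero, evalSums_X_one, ← mul_assoc]

/-! ### The grading -/

theorem mk_ofPath_mem_degreePart {i j : Quiver.Symmetrify (CyclicQuiver n)}
    (p : Quiver.Path i j) : Preprojective.mk k (CyclicQuiver n) (PathAlgebra.ofPath p) ∈
      Preprojective.degreePart k (CyclicQuiver n) p.length :=
  Submodule.subset_span ⟨i, j, p, rfl, rfl⟩

theorem e_mem_degreePart (i : ZMod n) : e k i ∈ Preprojective.degreePart k (CyclicQuiver n) 0 :=
  Submodule.subset_span ⟨i, i, Quiver.Path.nil, Quiver.Path.length_nil, rfl⟩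

theorem mul_arrow_mem_degreePart {d : ℕ} {r : PreprojectiveA k n}
    (hr : r ∈ Preprojective.degreePart k (CyclicQuiver n) d)
    {j l : Quiver.Symmetrify (CyclicQuiver n)} (f : j ⟶ l) :
    r * Preprojective.mk k (CyclicQuiver n) (PathAlgebra.arrow f) ∈
      Preprojective.degreePart k (CyclicQuiver n) (d + 1) := by
  induction hr using Submodule.span_induction with
  | zero => rw [zero_mul]; exact zero_mem _
  | add r s _ _ hr hs => rw [add_mul]; exact add_mem hr hs
  | smul c r _ hr => rw [smul_mul_assoc]; exact Submodule.smul_mem _ _ hr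
  | mem r hr =>
    obtain ⟨i, j', p, rfl, rfl⟩ := hr
    by_cases h : j' = j
    · subst h
      rw [← mk_ofPath_cons]
      exact mk_ofPath_mem_degreePart k (p.cons f)
    · rw [← map_mul, PathAlgebra.arrow, PathAlgebra.ofPath_mul_ofPath_of_ne _ _ h, map_zero]
      exact zero_mem _

theorem mul_sumα_mem_degreePart {d : ℕ} {r : PreprojectiveA k n}
    (hr : r ∈ Preprojective.degreePart k (CyclicQuiver n) d) :
    r * sumα k n ∈ Preprojective.degreePart k (CyclicQuiver n) (d + 1) := by
  rw [sumα, Finset.mul_sum]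
  exact sum_mem fun i _ => mul_arrow_mem_degreePart k hr _

theorem mul_sumαStar_mem_degreePart {d : ℕ} {r : PreprojectiveA k n}
    (hr : r ∈ Preprojective.degreePart k (CyclicQuiver n) d) :
    r * sumαStar k n ∈ Preprojective.degreePart k (CyclicQuiver n) (d + 1) := by
  rw [sumαStar, Finset.mul_sum]
  exact sum_mem fun i _ => mul_arrow_mem_degreePart k hr _

theorem one_mem_degreePart :
    (1 : PreprojectiveA k n) ∈ Preprojective.degreePart k (CyclicQuiver n) 0 := by
  rw [← sum_e]
  exact sum_mem fun i _ => e_mem_degreePart k i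

variable (n)

theorem s₁_mem_degreePart : s₁ k n ∈ Preprojective.degreePart k (CyclicQuiver n) 1 := by
  have h := one_mem_degreePart k (n := n)
  rw [s₁_eq, ← one_mul (sumα k n), ← one_mul (sumαStar k n)]
  exact add_mem (mul_sumα_mem_degreePart k h) (mul_sumαStar_mem_degreePart k h)

theorem s₂_mem_degreePart : s₂ k n ∈ Preprojective.degreePart k (CyclicQuiver n) 2 := by
  have h := one_mem_degreePart k (n := n)
  rw [s₂_eq, pow_two, pow_two, ← one_mul (sumα k n * _), ← one_mul (sumαStar k n * _),
    ← mul_assoc, ← mul_assoc]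
  exact add_mem (mul_sumα_mem_degreePart k (mul_sumα_mem_degreePart k h))
    (mul_sumαStar_mem_degreePart k (mul_sumαStar_mem_degreePart k h))

end Coordinates

/-! ### The fixed ring of the dihedral group -/

section Invariants

variable (k : Type u) [CommRing k] (n : ℕ) [NeZero n]

theorem rotation_sumα : rotation k n (sumα k n) = sumα k n := by
  rw [sumα, map_sum]
  simp only [rotation_α]
  exact Equiv.sum_comp (Equiv.addRight (1 : ZMod n)) (α k)

theorem rotation_sumαStar : rotation k n (sumαStar k n) = sumαStar k n := by
  rw [sumαStar, map_sum]
  simp only [rotation_αStar]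
  exact Equiv.sum_comp (Equiv.addRight (1 : ZMod n)) (αStar k)

theorem reflection_sumα : reflection k n (sumα k n) = sumαStar k n := by
  rw [sumα, sumαStar, map_sum]
  simp only [reflection_α]
  exact Equiv.sum_comp ((Equiv.neg (ZMod n)).trans (Equiv.subRight 1)) (αStar k)

theorem reflection_sumαStar : reflection k n (sumαStar k n) = sumα k n := by
  rw [sumα, sumαStar, map_sum]
  simp only [reflection_αStar]
  exact Equiv.sum_comp ((Equiv.neg (ZMod n)).trans (Equiv.subRight 1)) (α k)

variable {n}

theorem rotation_evalSums (p : MvPolynomial (Fin 2) k) :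
    rotation k n (evalSums k n p) = evalSums k n p := by
  suffices h : (rotation k n : PreprojectiveA k n →ₐ[k] PreprojectiveA k n).comp (evalSums k n) =
      evalSums k n from DFunLike.congr_fun h p
  ext j
  fin_cases j
  · exact (congrArg _ (evalSums_X_zero k n)).trans
      ((rotation_sumα k n).trans (evalSums_X_zero k n).symm)
  · exact (congrArg _ (evalSums_X_one k n)).trans
      ((rotation_sumαStar k n).trans (evalSums_X_one k n).symm)

theorem reflection_evalSums (p : MvPolynomial (Fin 2) k) :
    reflection k n (evalSums k n p) = evalSums k n (rename (Equiv.swap 0 1) p) := by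
  suffices h : (reflection k n : PreprojectiveA k n →ₐ[k] PreprojectiveA k n).comp
      (evalSums k n) = (evalSums k n).comp (rename (Equiv.swap 0 1)) from DFunLike.congr_fun h p
  ext j
  fin_cases j
  · simp [evalSums_X_zero, evalSums_X_one, reflection_sumα]
  · simp [evalSums_X_zero, evalSums_X_one, reflection_sumαStar]

theorem mem_invariants_iff (r : PreprojectiveA k n) :
    r ∈ invariants k n ↔ rotation k n r = r ∧ reflection k n r = r := by
  constructor
  · intro h
    exact ⟨h ⟨rotation k n, Subgroup.subset_closure (by simp)⟩,
      h ⟨reflection k n, Subgroup.subset_closure (by simp)⟩⟩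
  · rintro ⟨h, h'⟩ ⟨g, hg⟩
    -- The stabilizer is a subgroup, so it suffices that it contains the two generators.
    have : dihedral k n ≤ MulAction.stabilizer _ r := by
      rw [dihedral, Subgroup.closure_le]
      rintro _ (rfl | rfl)
      exacts [h, h']
    exact this hg

theorem isSymmetric_iff_rename_swap (p : MvPolynomial (Fin 2) k) :
    p.IsSymmetric ↔ rename (Equiv.swap 0 1) p = p := by
  refine ⟨fun h => h _, fun h σ => ?_⟩
  obtain rfl | rfl := (by decide : ∀ σ : Equiv.Perm (Fin 2), σ = 1 ∨ σ = Equiv.swap 0 1) σ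
  · exact rename_id_apply p
  · exact h

theorem evalSums_mem_invariants_iff (p : MvPolynomial (Fin 2) k) :
    evalSums k n p ∈ invariants k n ↔ p.IsSymmetric := by
  rw [mem_invariants_iff, isSymmetric_iff_rename_swap, reflection_evalSums,
    (evalSums_injective k).eq_iff, and_iff_right (rotation_evalSums k p)]

/-- The rotation shifts the family of coordinates, and 1 generates `ZMod n`, so an invariant element
has constant coordinates. As the idempotents sum to 1, it is a polynomial in the arrow sums, and the
reflection forces that polynomial to be symmetric. -/
theorem exists_evalSums_eq_of_mem_invariants {r : PreprojectiveA k n} (hr : r ∈ invariants k n) :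
    ∃ p : MvPolynomial (Fin 2) k, p.IsSymmetric ∧ evalSums k n p = r := by
  obtain ⟨f, rfl⟩ := ofPolynomials_surjective k r
  have h : rotation k n (ofPolynomials k n f) = ofPolynomials k n fun i => f (i - 1) := by
    rw [ofPolynomials_apply, ofPolynomials_apply, map_sum]
    simp only [map_mul, rotation_e, rotation_evalSums]
    rw [← Equiv.sum_comp (Equiv.addRight (1 : ZMod n))
      fun i => e k i * evalSums k n (f (i - 1))]
    simp
  rw [((mem_invariants_iff k _).1 hr).1] at h
  have h' (i : ZMod n) : f (i - 1) = f i := (congrFun (ofPolynomials_injective k h) i).symm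
  have hf (m : ℕ) : f (m : ZMod n) = f 0 := by
    induction m with
    | zero => rw [Nat.cast_zero]
    | succ m ih => rw [← ih, ← h', Nat.cast_succ, add_sub_cancel_right]
  have hconst : f = fun _ => f 0 := by
    funext i
    rw [← ZMod.natCast_zmod_val i, hf]
  rw [hconst, ofPolynomials_const] at hr ⊢
  exact ⟨f 0, (evalSums_mem_invariants_iff k _).1 hr, rfl⟩

/-! ### The fixed ring as a polynomial ring on two power sums. -/

variable (n)

/-- The fixed ring of the dihedral group is the ring of symmetric polynomials in two variables. -/
def symmetricEquivInvariants : symmetricSubalgebra (Fin 2) k ≃ₐ[k] invariants k n :=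
  AlgEquiv.ofBijective
    (((evalSums k n).comp (symmetricSubalgebra (Fin 2) k).val).codRestrict (invariants k n)
      fun p => (evalSums_mem_invariants_iff k _).2 p.2)
    ⟨fun p q h => Subtype.ext (evalSums_injective k
      (show evalSums k n p = evalSums k n q from
        congrArg (fun r : invariants k n => (r : PreprojectiveA k n)) h)), fun r => by
      obtain ⟨p, hp, h⟩ := exists_evalSums_eq_of_mem_invariants k r.2
      exact ⟨⟨p, hp⟩, Subtype.ext h⟩⟩

theorem coe_symmetricEquivInvariants (p : symmetricSubalgebra (Fin 2) k) :
    (symmetricEquivInvariants k n p : PreprojectiveA k n) = evalSums k n p := rfl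

theorem sumα_add_sumαStar_mem_invariants : sumα k n + sumαStar k n ∈ invariants k n := by
  rw [mem_invariants_iff, map_add, map_add, rotation_sumα, rotation_sumαStar, reflection_sumα,
    reflection_sumαStar]
  exact ⟨rfl, add_comm _ _⟩

theorem sumα_mul_sumαStar_mem_invariants : sumα k n * sumαStar k n ∈ invariants k n := by
  rw [mem_invariants_iff, map_mul, map_mul, rotation_sumα, rotation_sumαStar, reflection_sumα,
    reflection_sumαStar]
  exact ⟨rfl, (sumα_mul_sumαStar k n).symm⟩

/-- The automorphism of the polynomial ring in two variables expressing the second power sum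
through the elementary symmetric polynomials. -/
def powerSumEquiv [Invertible (2 : k)] : MvPolynomial (Fin 2) k ≃ₐ[k] MvPolynomial (Fin 2) k :=
  -- Newton's identity `p₂ = e₁ ^ 2 - 2 * e₂`; solving it for `e₂` is where 2 has to be invertible.
  AlgEquiv.ofAlgHom (aeval ![X 0, X 0 ^ 2 - 2 * X 1])
    (aeval ![X 0, C (⅟2 : k) * (X 0 ^ 2 - X 1)])
    (by
      have h : (C (⅟2 : k) * 2 : MvPolynomial (Fin 2) k) = 1 := by
        rw [← map_ofNat C, ← C_mul, invOf_mul_self, C_1]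
      ext j : 1
      fin_cases j
      · simp
      · simp [algebraMap_eq, ← mul_assoc, h])
    (by
      have h : (2 * C (⅟2 : k) : MvPolynomial (Fin 2) k) = 1 := by
        rw [← map_ofNat C, ← C_mul, mul_invOf_self, C_1]
      ext j : 1
      fin_cases j
      · simp
      · simp [map_ofNat, ← mul_assoc, h])

/-- Indices are shifted by one: the variable `X i` goes to the elementary symmetric polynomial of
degree `i + 1`. -/
theorem esymmAlgEquiv_X_zero :
    (esymmAlgEquiv (Fin 2) k (Fintype.card_fin 2) (X 0) : MvPolynomial (Fin 2) k) =
      X 0 + X 1 := by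
  rw [esymmAlgEquiv_apply, esymmAlgHom, aeval_X]
  simp

theorem esymmAlgEquiv_X_one :
    (esymmAlgEquiv (Fin 2) k (Fintype.card_fin 2) (X 1) : MvPolynomial (Fin 2) k) =
      X 0 * X 1 := by
  rw [esymmAlgEquiv_apply, esymmAlgHom, aeval_X]
  exact (congrFun (esymm_eq_multiset_esymm (Fin 2) k) 2).trans (Multiset.esymm_pair_two _ _)

/-- The fixed ring of the dihedral group is a polynomial ring in two variables. -/
def polynomialEquivInvariants [Invertible (2 : k)] :
    MvPolynomial (Fin 2) k ≃ₐ[k] invariants k n :=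
  ((powerSumEquiv k).trans (esymmAlgEquiv (Fin 2) k (Fintype.card_fin 2))).trans
    (symmetricEquivInvariants k n)

theorem polynomialEquivInvariants_X_zero [Invertible (2 : k)] :
    (polynomialEquivInvariants k n (X 0) : PreprojectiveA k n) = s₁ k n := by
  have h : powerSumEquiv k (X 0) = X 0 := by simp [powerSumEquiv]
  rw [polynomialEquivInvariants, AlgEquiv.trans_apply, AlgEquiv.trans_apply, h,
    coe_symmetricEquivInvariants, esymmAlgEquiv_X_zero, map_add, evalSums_X_zero, evalSums_X_one,
    s₁_eq]

theorem polynomialEquivInvariants_X_one [Invertible (2 : k)] :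
    (polynomialEquivInvariants k n (X 1) : PreprojectiveA k n) = s₂ k n := by
  have h : powerSumEquiv k (X 1) = X 0 ^ 2 - 2 * X 1 := by simp [powerSumEquiv]
  have h' : ((X 0 + X 1) ^ 2 - 2 * (X 0 * X 1) : MvPolynomial (Fin 2) k) = X 0 ^ 2 + X 1 ^ 2 := by
    ring
  have h'' : (esymmAlgEquiv (Fin 2) k (Fintype.card_fin 2) (X 0 ^ 2 - 2 * X 1) :
      MvPolynomial (Fin 2) k) = X 0 ^ 2 + X 1 ^ 2 := by
    rw [← h', ← esymmAlgEquiv_X_zero, ← esymmAlgEquiv_X_one, map_sub, map_mul, map_pow,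
      map_ofNat]
    rfl
  rw [polynomialEquivInvariants, AlgEquiv.trans_apply, AlgEquiv.trans_apply, h,
    coe_symmetricEquivInvariants, h'', map_add, map_pow, map_pow, evalSums_X_zero, evalSums_X_one,
    s₂_eq]

end Invariants

/-! ### Orbits of powers -/

section Orbits

variable (k : Type u) [CommRing k] {n : ℕ} [NeZero n]

/-- The family of all `e i * x ^ a` and `e i * y ^ a`, where `x` is the sum of the nonstar arrows
and `y` the sum of the star arrows. -/
def powerFamily (a : ℕ) : ZMod n ⊕ ZMod n → PreprojectiveA k n :=
  Sum.elim (fun i => e k i * sumα k n ^ a) (fun i => e k i * sumαStar k n ^ a)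

/-- The exponent 1 gives all arrows and the exponent 2 all paths of two arrows of the same kind, so
one family serves both orbit sums. -/
theorem rotation_powerFamily (a : ℕ) (j : ZMod n ⊕ ZMod n) :
    rotation k n (powerFamily k a j) =
      powerFamily k a (Equiv.sumCongr (Equiv.addRight 1) (Equiv.addRight 1) j) := by
  cases j <;> simp [powerFamily, rotation_e, rotation_sumα, rotation_sumαStar]

theorem reflection_powerFamily (a : ℕ) (j : ZMod n ⊕ ZMod n) :
    reflection k n (powerFamily k a j) =
      powerFamily k a
        (((Equiv.neg _).sumCongr (Equiv.neg _)).trans (Equiv.sumComm _ _) j) := by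
  cases j <;> simp [powerFamily, reflection_e, reflection_sumα, reflection_sumαStar]

theorem exists_perm_smul_powerFamily (a : ℕ) (g : dihedral k n) :
    ∃ σ : Equiv.Perm (ZMod n ⊕ ZMod n), ∀ j, g • powerFamily k a j = powerFamily k a (σ j) := by
  obtain ⟨g, hg⟩ := g
  change ∃ σ : Equiv.Perm (ZMod n ⊕ ZMod n), ∀ j, g (powerFamily k a j) = powerFamily k a (σ j)
  induction hg using Subgroup.closure_induction with
  | mem g hg =>
    obtain rfl | rfl := hg
    · exact ⟨_, rotation_powerFamily k a⟩
    · exact ⟨_, reflection_powerFamily k a⟩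
  | one => exact ⟨1, fun j => rfl⟩
  | mul g h _ _ hg hh =>
    obtain ⟨σ, hσ⟩ := hg
    obtain ⟨τ, hτ⟩ := hh
    exact ⟨σ * τ, fun j => by rw [AlgEquiv.mul_apply, hτ, hσ]; rfl⟩
  | inv g _ hg =>
    obtain ⟨σ, hσ⟩ := hg
    refine ⟨σ⁻¹, fun j => ?_⟩
    have h := hσ (σ⁻¹ j)
    rw [show σ (σ⁻¹ j) = j from σ.apply_symm_apply j] at h
    rw [← h]
    exact g.symm_apply_apply _

/-- Rotations reach every nonstar index from 0, and the reflection carries the nonstar index `-i` to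
the star index `i`. -/
theorem orbit_powerFamily (a : ℕ) :
    MulAction.orbit (dihedral k n) (powerFamily k a (Sum.inl (0 : ZMod n))) =
      Set.range (powerFamily k a) := by
  let ρ : dihedral k n := ⟨rotation k n, Subgroup.subset_closure (by simp)⟩
  let τ : dihedral k n := ⟨reflection k n, Subgroup.subset_closure (by simp)⟩
  have h (i : ZMod n) : powerFamily k a (Sum.inl i) ∈
      MulAction.orbit (dihedral k n) (powerFamily k a (Sum.inl (0 : ZMod n))) := by
    rw [← ZMod.natCast_zmod_val i]
    induction i.val with
    | zero => rw [Nat.cast_zero]; exact MulAction.mem_orbit_self _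
    | succ m ih =>
      have := rotation_powerFamily k a (Sum.inl (m : ZMod n))
      rw [Nat.cast_succ]
      exact this ▸ MulAction.mem_orbit_of_mem_orbit ρ ih
  refine subset_antisymm ?_ ?_
  · rintro _ ⟨g, rfl⟩
    obtain ⟨σ, hσ⟩ := exists_perm_smul_powerFamily k a g
    exact ⟨_, (hσ _).symm⟩
  · rintro _ ⟨i | i, rfl⟩
    · exact h i
    · have := reflection_powerFamily k a (Sum.inl (-i))
      simp only [Equiv.trans_apply, Equiv.sumCongr_apply, Sum.map_inl, Equiv.neg_apply, neg_neg,
        Equiv.sumComm_apply, Sum.swap_inl] at this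
      exact this ▸ MulAction.mem_orbit_of_mem_orbit τ (h (-i))

theorem toPolynomials_powerFamily (a : ℕ) (j : ZMod n ⊕ ZMod n) :
    toPolynomials k n (powerFamily k a j) =
      Sum.elim (fun i => Pi.single i (X 0 ^ a)) (fun i => Pi.single i (X 1 ^ a)) j := by
  cases j with
  | inl i =>
    rw [Sum.elim_inl, ← toPolynomials_ofPolynomials k (Pi.single i (X 0 ^ a)),
      ofPolynomials_single, map_pow, evalSums_X_zero]
    rfl
  | inr i =>
    rw [Sum.elim_inr, ← toPolynomials_ofPolynomials k (Pi.single i (X 1 ^ a)),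
      ofPolynomials_single, map_pow, evalSums_X_one]
    rfl

/-- An orbit sum counts each element once, so it equals the sum over the indices only if there are
no repetitions. For `a = 0` both halves of the family would consist of the same idempotents. -/
theorem powerFamily_injective [Nontrivial k] {a : ℕ} (ha : a ≠ 0) :
    Function.Injective (powerFamily k (n := n) a) := by
  have hsingle {i j : ZMod n} {p q : MvPolynomial (Fin 2) k} {c : Fin 2 → k}
      (hp : eval c p = 1) (h : (Pi.single i p : ZMod n → MvPolynomial (Fin 2) k) =
        Pi.single j q) : i = j ∧ p = q := by
    have hi := congrFun h i
    rw [Pi.single_eq_same] at hi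
    by_cases hij : i = j
    · subst hij
      exact ⟨rfl, by rwa [Pi.single_eq_same] at hi⟩
    · rw [Pi.single_eq_of_ne hij] at hi
      rw [hi, map_zero] at hp
      exact (zero_ne_one hp).elim
  have hne : (X 0 ^ a : MvPolynomial (Fin 2) k) ≠ X 1 ^ a := fun h => by
    -- At the point `(1, 0)` the two powers take the values 1 and 0.
    simpa [ha] using congrArg (eval ![(1 : k), 0]) h
  intro j j' h
  have h := congrArg (toPolynomials k n) h
  rw [toPolynomials_powerFamily, toPolynomials_powerFamily] at h
  rcases j with i | i <;> rcases j' with i' | i' <;> simp only [Sum.elim_inl, Sum.elim_inr] at h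
  · rw [(hsingle (c := fun _ => 1) (by simp) h).1]
  · exact (hne (hsingle (c := fun _ => 1) (by simp) h).2).elim
  · exact (hne (hsingle (c := fun _ => 1) (by simp) h).2.symm).elim
  · rw [(hsingle (c := fun _ => 1) (by simp) h).1]

theorem orbitSum_powerFamily [Nontrivial k] {a : ℕ} (ha : a ≠ 0) :
    orbitSum (dihedral k n) (powerFamily k a (Sum.inl (0 : ZMod n))) =
      sumα k n ^ a + sumαStar k n ^ a := by
  rw [orbitSum, orbit_powerFamily, finsum_mem_range (powerFamily_injective k ha),
    finsum_eq_sum_of_fintype, Fintype.sum_sum_type]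
  simp only [powerFamily, Sum.elim_inl, Sum.elim_inr]
  rw [← Finset.sum_mul, ← Finset.sum_mul, sum_e, one_mul, one_mul]

variable (n)

theorem s₁_eq_orbitSum [Nontrivial k] : s₁ k n = orbitSum (dihedral k n) (α k (0 : ZMod n)) := by
  have h : α k (0 : ZMod n) = powerFamily k 1 (Sum.inl 0) := by
    rw [powerFamily, Sum.elim_inl, pow_one, e_mul_sumα]
  rw [h, orbitSum_powerFamily k one_ne_zero, s₁_eq, pow_one, pow_one]

theorem s₂_eq_orbitSum [Nontrivial k] :
    s₂ k n = orbitSum (dihedral k n) (α k (0 : ZMod n) * α k (1 : ZMod n)) := by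
  have h : α k (0 : ZMod n) * α k (1 : ZMod n) = powerFamily k 2 (Sum.inl 0) := by
    rw [powerFamily, Sum.elim_inl, pow_two, ← mul_assoc, e_mul_sumα, α_mul_sumα, zero_add]
  rw [h, orbitSum_powerFamily k two_ne_zero, s₂_eq]

end Orbits

/-! ### Freeness over the fixed ring -/

section Freeness

variable (k : Type u) [CommRing k] {n : ℕ} [NeZero n]

/-- Spanning over the fixed ring, with degrees recorded. It is applied with a constant `N` to prove
that the candidate basis spans, and with preimages of the shifted degree parts to compute the degree
of `lowering`. -/
theorem monomial_mem_of_mul_mem (N : ℕ → Submodule k (PreprojectiveA k n))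
    (hadd : ∀ d, ∀ r ∈ N d, r * (sumα k n + sumαStar k n) ∈ N (d + 1))
    (hmul : ∀ d, ∀ r ∈ N d, r * (sumα k n * sumαStar k n) ∈ N (d + 2)) {i : ZMod n}
    (he : e k i ∈ N 0) (hα : α k i ∈ N 1) :
    ∀ a b : ℕ, e k i * sumα k n ^ a * sumαStar k n ^ b ∈ N (a + b)
  | 0, 0 => by simpa using he
  | 1, 0 => by simpa [e_mul_sumα] using hα
  -- `e i * y = e i * (x + y) - α i`.
  | 0, 1 => by
    have h := sub_mem (hadd 0 _ he) hα
    rw [mul_add, e_mul_sumα, add_sub_cancel_left] at h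
    simpa using h
  | a + 1, b + 1 => by
    have h := hmul _ _ (monomial_mem_of_mul_mem N hadd hmul he hα a b)
    have hc := ((show Commute (sumα k n) (sumαStar k n) from sumα_mul_sumαStar k n).pow_right b).eq
    rw [mul_assoc, ← mul_assoc (sumαStar k n ^ b), ← hc, mul_assoc (sumα k n), ← pow_succ,
      ← mul_assoc, mul_assoc (e k i), ← pow_succ] at h
    rwa [show a + 1 + (b + 1) = a + b + 2 by ring]
  -- `x ^ (a + 2) = x ^ (a + 1) * (x + y) - x ^ a * (x * y)`; the last case is the same with `x` and
  -- `y` exchanged.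
  | a + 2, 0 => by
    have h := sub_mem (hadd _ _ (monomial_mem_of_mul_mem N hadd hmul he hα (a + 1) 0))
      (hmul _ _ (monomial_mem_of_mul_mem N hadd hmul he hα a 0))
    rw [pow_zero, mul_one, mul_one, mul_add, mul_assoc, ← pow_succ, pow_succ _ a,
      ← mul_assoc _ _ (sumα k n), ← mul_assoc _ (sumα k n) (sumαStar k n),
      add_sub_cancel_right] at h
    simpa using h
  | 0, b + 2 => by
    have h := sub_mem (hadd _ _ (monomial_mem_of_mul_mem N hadd hmul he hα 0 (b + 1)))
      (hmul _ _ (monomial_mem_of_mul_mem N hadd hmul he hα 0 b))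
    rw [pow_zero, mul_one, sumα_mul_sumαStar, mul_add, mul_assoc _ _ (sumαStar k n), ← pow_succ,
      pow_succ _ b, ← mul_assoc _ _ (sumαStar k n), ← mul_assoc _ (sumαStar k n) (sumα k n),
      add_sub_cancel_left] at h
    rw [zero_add] at h
    simpa using h
termination_by a b => a + b

theorem op_smul_def (s : (invariants k n).op) (r : PreprojectiveA k n) :
    s • r = r * (s : (PreprojectiveA k n)ᵐᵒᵖ).unop := rfl

/-- Swapping the variables fixes `p` and `q`; subtracting the swapped equation leaves `(X 0 - X 1) *
q = 0` in a domain. -/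
theorem eq_zero_of_add_X_mul_eq_zero {p q : MvPolynomial (Fin 2) k} [IsDomain k]
    (hp : p.IsSymmetric) (hq : q.IsSymmetric) (h : p + X 0 * q = 0) : p = 0 ∧ q = 0 := by
  have h' := congrArg (rename (Equiv.swap (0 : Fin 2) 1)) h
  rw [map_add, map_mul, hp, hq, rename_X, Equiv.swap_apply_left, map_zero] at h'
  have hX : (X 0 - X 1 : MvPolynomial (Fin 2) k) ≠ 0 :=
    sub_ne_zero.2 fun h => zero_ne_one (X_injective h)
  have hq0 : q = 0 := by
    refine (mul_eq_zero.1 (?_ : (X 0 - X 1) * q = 0)).resolve_left hX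
    linear_combination h - h'
  exact ⟨by simpa [hq0] using h, hq0⟩

/-- Since `α i = e i * x`, a relation has `i`-th coordinate `p + X 0 * q` with `p` and `q`
symmetric, and the coordinates are unique. -/
theorem linearIndependent_e_α [IsDomain k] :
    LinearIndependent (invariants k n).op
      (Sum.elim (e k) (α k) : ZMod n ⊕ ZMod n → PreprojectiveA k n) := by
  rw [Fintype.linearIndependent_iff]
  intro g hg
  choose p hp hpg using fun j =>
    exists_evalSums_eq_of_mem_invariants k (Subalgebra.mem_op.1 (g j).2)
  have h : ofPolynomials k n (fun i => p (Sum.inl i) + X 0 * p (Sum.inr i)) = 0 := by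
    rw [← hg, Fintype.sum_sum_type, ← Finset.sum_add_distrib, ofPolynomials_apply]
    refine Finset.sum_congr rfl fun i _ => ?_
    rw [Sum.elim_inl, Sum.elim_inr, op_smul_def, op_smul_def, ← hpg, ← hpg, map_add, map_mul,
      evalSums_X_zero, mul_add, ← mul_assoc, e_mul_sumα]
  have h0 (i : ZMod n) := eq_zero_of_add_X_mul_eq_zero k (hp (Sum.inl i)) (hp (Sum.inr i))
    (congrFun (ofPolynomials_injective k (h.trans (map_zero _).symm)) i)
  intro j
  refine Subtype.ext (MulOpposite.unop_injective ((hpg j).symm.trans ?_))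
  cases j with
  | inl i => rw [(h0 i).1]; exact map_zero _
  | inr i => rw [(h0 i).2]; exact map_zero _

theorem mul_mem_of_mem_invariants
    (N : Submodule (invariants k n).op (PreprojectiveA k n)) {r s : PreprojectiveA k n}
    (hr : r ∈ N) (hs : s ∈ invariants k n) : r * s ∈ N :=
  N.smul_mem (⟨MulOpposite.op s, hs⟩ : (invariants k n).op) hr

theorem span_e_α : Submodule.span (invariants k n).op
    (Set.range (Sum.elim (e k) (α k) : ZMod n ⊕ ZMod n → PreprojectiveA k n)) = ⊤ := by
  set N := Submodule.span (invariants k n).op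
    (Set.range (Sum.elim (e k) (α k) : ZMod n ⊕ ZMod n → PreprojectiveA k n))
  have h : N.restrictScalars k = ⊤ := by
    rw [eq_top_iff, ← span_monomials_eq_top, Submodule.span_le]
    rintro _ ⟨⟨i, a, b⟩, rfl⟩
    exact monomial_mem_of_mul_mem k (fun _ => N.restrictScalars k)
      (fun _ r hr => mul_mem_of_mem_invariants k N hr (sumα_add_sumαStar_mem_invariants k n))
      (fun _ r hr => mul_mem_of_mem_invariants k N hr (sumα_mul_sumαStar_mem_invariants k n))
      (Submodule.subset_span ⟨Sum.inl i, rfl⟩) (Submodule.subset_span ⟨Sum.inr i, rfl⟩) a b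
  rwa [Submodule.restrictScalars_eq_top_iff] at h

variable (n)

/-- The basis of the preprojective algebra over the fixed ring of the dihedral group formed by the
vertices and the nonstar arrows. -/
def basisInvariants [IsDomain k] :
    Module.Basis (ZMod n ⊕ ZMod n) (invariants k n).op (PreprojectiveA k n) :=
  Module.Basis.mk (linearIndependent_e_α k) (span_e_α k).ge

variable {n}

theorem basisInvariants_inl [IsDomain k] (i : ZMod n) :
    basisInvariants k n (Sum.inl i) = e k i := Module.Basis.mk_apply ..

theorem basisInvariants_inr [IsDomain k] (i : ZMod n) :
    basisInvariants k n (Sum.inr i) = α k i := Module.Basis.mk_apply ..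

end Freeness

/-! ### An endomorphism of degree `-1` -/

section Lowering

variable (k : Type u) [CommRing k] (n : ℕ) [NeZero n]

/-- The endomorphism over the fixed ring that kills the vertices and sends every nonstar arrow to
its source. -/
def lowering [IsDomain k] : InvariantEnd k (PreprojectiveA k n) (dihedral k n) :=
  (basisInvariants k n).constr ℕ (Sum.elim 0 (e k))

variable {n}

theorem lowering_e [IsDomain k] (i : ZMod n) : lowering k n (e k i) = 0 := by
  rw [← basisInvariants_inl, lowering, Module.Basis.constr_basis]
  rfl

theorem lowering_α [IsDomain k] (i : ZMod n) : lowering k n (α k i) = e k i := by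
  rw [← basisInvariants_inr, lowering, Module.Basis.constr_basis]
  rfl

theorem invariantEnd_mul (f : InvariantEnd k (PreprojectiveA k n) (dihedral k n))
    (r : PreprojectiveA k n) {s : PreprojectiveA k n} (hs : s ∈ invariants k n) :
    f (r * s) = f r * s :=
  f.map_smul (⟨MulOpposite.op s, hs⟩ : (invariants k n).op) r

variable (n) in
/-- The degree parts of the preprojective algebra, shifted by one. -/
def shiftedDegreePart : ℕ → Submodule k (PreprojectiveA k n)
  -- With zero in degree 0, the vanishing on `R_0` and the lowering of all other degrees become a
  -- single statement.
  | 0 => ⊥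
  | d + 1 => Preprojective.degreePart k (CyclicQuiver n) d

theorem mul_add_mem_shiftedDegreePart :
    ∀ d, ∀ r ∈ shiftedDegreePart k n d,
      r * (sumα k n + sumαStar k n) ∈ shiftedDegreePart k n (d + 1)
  | 0, r, hr => by
    rw [(Submodule.mem_bot k).1 hr, zero_mul]
    exact zero_mem _
  | d + 1, r, hr => by
    rw [mul_add]
    exact add_mem (mul_sumα_mem_degreePart k hr) (mul_sumαStar_mem_degreePart k hr)

theorem mul_mul_mem_shiftedDegreePart :
    ∀ d, ∀ r ∈ shiftedDegreePart k n d,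
      r * (sumα k n * sumαStar k n) ∈ shiftedDegreePart k n (d + 2)
  | 0, r, hr => by
    rw [(Submodule.mem_bot k).1 hr, zero_mul]
    exact zero_mem _
  | d + 1, r, hr => by
    rw [← mul_assoc]
    exact mul_sumαStar_mem_degreePart k (mul_sumα_mem_degreePart k hr)

theorem lowering_α_mem_shiftedDegreePart [IsDomain k] (i : ZMod n) :
    lowering k n (α k i) ∈ shiftedDegreePart k n 1 := by
  rw [lowering_α]
  exact e_mem_degreePart k i

/-- Linearity over the fixed ring carries the factors `x + y` and `x * y` outside `lowering`, so
only its values on `e i` and `α i` need checking. -/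
theorem lowering_mem_shiftedDegreePart [IsDomain k] {d : ℕ} {r : PreprojectiveA k n}
    (hr : r ∈ Preprojective.degreePart k (CyclicQuiver n) d) :
    lowering k n r ∈ shiftedDegreePart k n d := by
  let L : PreprojectiveA k n →ₗ[k] PreprojectiveA k n := (lowering k n).restrictScalars k
  suffices h : Preprojective.degreePart k (CyclicQuiver n) d ≤
      (shiftedDegreePart k n d).comap L from h hr
  rw [Preprojective.degreePart, Submodule.span_le]
  rintro _ ⟨i, j, p, rfl, rfl⟩
  obtain ⟨a, b, hab, h⟩ := exists_mk_ofPath_eq k p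
  rw [h, ← hab]
  refine monomial_mem_of_mul_mem k (fun d => (shiftedDegreePart k n d).comap L) ?_ ?_ ?_ ?_ a b
  · intro d r hr
    have h : lowering k n r * (sumα k n + sumαStar k n) ∈ shiftedDegreePart k n (d + 1) :=
      mul_add_mem_shiftedDegreePart k d _ hr
    rw [← invariantEnd_mul k _ r (sumα_add_sumαStar_mem_invariants k n)] at h
    exact h
  · intro d r hr
    have h : lowering k n r * (sumα k n * sumαStar k n) ∈ shiftedDegreePart k n (d + 2) :=
      mul_mul_mem_shiftedDegreePart k d _ hr
    rw [← invariantEnd_mul k _ r (sumα_mul_sumαStar_mem_invariants k n)] at h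
    exact h
  · exact lowering_e k i
  · exact lowering_α_mem_shiftedDegreePart k i

/-! ### The obstruction to lying in the image of the Auslander map. -/

variable (n) in
/-- The augmentation, killing all arrows. -/
def augmentation : PreprojectiveA k n →ₐ[k] (ZMod n → k) :=
  lift k (fun i => Pi.single i 1) 0 0 (Finset.univ_sum_single 1)
    (fun i j => by
      split_ifs with h
      · subst h
        rw [← Pi.single_mul, one_mul]
      · funext l
        rcases eq_or_ne l i with rfl | hl
        · simp [Pi.single_eq_of_ne h]
        · simp [Pi.single_eq_of_ne hl])
    (fun i => mul_zero _) (fun i => zero_mul _) (fun i => mul_zero _) (fun i => zero_mul _)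
    (by simp)

/-- The group permutes the arrows of the double quiver, and the augmentation kills all of them. -/
theorem augmentation_smul_α (g : dihedral k n) (i : ZMod n) :
    augmentation k n (g • α k i) = 0 := by
  have hα : α k i = powerFamily k 1 (Sum.inl i) := by
    rw [powerFamily, Sum.elim_inl, pow_one, e_mul_sumα]
  obtain ⟨σ, hσ⟩ := exists_perm_smul_powerFamily k 1 g
  have hx : augmentation k n (sumα k n) = 0 := by
    rw [sumα, map_sum]
    exact Finset.sum_eq_zero fun i _ => lift_α ..
  have hy : augmentation k n (sumαStar k n) = 0 := by
    rw [sumαStar, map_sum]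
    exact Finset.sum_eq_zero fun i _ => lift_αStar ..
  rw [hα, hσ]
  rcases σ (Sum.inl i) with j | j
  · rw [powerFamily, Sum.elim_inl, pow_one, map_mul, hx, mul_zero]
  · rw [powerFamily, Sum.elim_inr, pow_one, map_mul, hy, mul_zero]

/-- By additivity it suffices to treat one `a # g`, which sends `α i` to a left multiple of an
arrow. The map `lowering` violates this, since `e 0` has nonzero augmentation. -/
theorem augmentation_auslanderMap_α
    (z : SkewMonoidAlgebra (PreprojectiveA k n) (dihedral k n)) (i : ZMod n) :
    augmentation k n (auslanderMap k (PreprojectiveA k n) (dihedral k n) z (α k i)) = 0 := by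
  induction z using SkewMonoidAlgebra.induction_on with
  | zero => rw [map_zero, LinearMap.zero_apply, map_zero]
  | single g a => rw [auslanderMap_single, map_mul, augmentation_smul_α, mul_zero]
  | add z z' h h' => rw [map_add, LinearMap.add_apply, map_add, h, h', add_zero]

theorem lowering_notMem_range_auslanderMap [IsDomain k] :
    lowering k n ∉ Set.range (auslanderMap k (PreprojectiveA k n) (dihedral k n)) := by
  rintro ⟨z, hz⟩
  have h := augmentation_auslanderMap_α k z 0
  rw [hz, lowering_α, augmentation, lift_e] at h
  simpa using congrFun h 0

end Lowering

end PreprojectiveA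

end

theorem theorem3 (k : Type*) [Field k] [IsAlgClosed k] [CharZero k] (n : ℕ) [NeZero n]
    (hn : 3 ≤ n) :
    ¬ Function.Bijective (auslanderMap k (PreprojectiveA k n) (PreprojectiveA.dihedral k n)) ∧
    (PreprojectiveA.s₁ k n = orbitSum (PreprojectiveA.dihedral k n)
        (PreprojectiveA.α k (0 : ZMod n)) ∧
      PreprojectiveA.s₂ k n = orbitSum (PreprojectiveA.dihedral k n)
        (PreprojectiveA.α k (0 : ZMod n) * PreprojectiveA.α k (1 : ZMod n)) ∧
      PreprojectiveA.s₁ k n ∈ Preprojective.degreePart k (CyclicQuiver n) 1 ∧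
      PreprojectiveA.s₂ k n ∈ Preprojective.degreePart k (CyclicQuiver n) 2 ∧
      ∃ φ : MvPolynomial (Fin 2) k ≃ₐ[k] PreprojectiveA.invariants k n,
        (φ (MvPolynomial.X 0) : PreprojectiveA k n) = PreprojectiveA.s₁ k n ∧
        (φ (MvPolynomial.X 1) : PreprojectiveA k n) = PreprojectiveA.s₂ k n) ∧
    (∃ b : Module.Basis (ZMod n ⊕ ZMod n) (PreprojectiveA.invariants k n).op (PreprojectiveA k n),
      (∀ i, b (Sum.inl i) = PreprojectiveA.e k i) ∧
      ∀ i, b (Sum.inr i) = PreprojectiveA.α k i) ∧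
    ∃ ψ : InvariantEnd k (PreprojectiveA k n) (PreprojectiveA.dihedral k n),
      (∀ x ∈ Preprojective.degreePart k (CyclicQuiver n) 0, ψ x = 0) ∧
      (∀ d, ∀ x ∈ Preprojective.degreePart k (CyclicQuiver n) (d + 1),
        ψ x ∈ Preprojective.degreePart k (CyclicQuiver n) d) ∧
      ψ ∉ Set.range (auslanderMap k (PreprojectiveA k n) (PreprojectiveA.dihedral k n)) := by
  let _ : Invertible (2 : k) := invertibleOfNonzero two_ne_zero
  have hψ := PreprojectiveA.lowering_notMem_range_auslanderMap k (n := n)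
  exact ⟨fun h => hψ (h.2 _),
    ⟨PreprojectiveA.s₁_eq_orbitSum k n, PreprojectiveA.s₂_eq_orbitSum k n,
      PreprojectiveA.s₁_mem_degreePart k n, PreprojectiveA.s₂_mem_degreePart k n,
      PreprojectiveA.polynomialEquivInvariants k n,
      PreprojectiveA.polynomialEquivInvariants_X_zero k n,
      PreprojectiveA.polynomialEquivInvariants_X_one k n⟩,
    ⟨PreprojectiveA.basisInvariants k n, PreprojectiveA.basisInvariants_inl k,
      PreprojectiveA.basisInvariants_inr k⟩,
    PreprojectiveA.lowering k n,
    -- In degree 0 the shifted part is `⊥`, so membership unfolds to vanishing.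
    fun _ hx => PreprojectiveA.lowering_mem_shiftedDegreePart k hx,
    fun _ _ hx => PreprojectiveA.lowering_mem_shiftedDegreePart k hx, hψ⟩
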